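/- **Setting.** Fix $\lambda_{\max}\in(0,\infty]$. A function $\psi:[0,\lambda_{\max})\to[0,\infty)$ is *CGF-like* if it is twice continuously differentiable, strictly convex, $\psi(0)=\psi'(0)=0$ and $\psi''(0)>0$. Let $(\Omega,\mathcal F,\mathbb P)$ be a probability space with a filtration $(\mathcal F_t)_{t\in\{0,1,2,\dots\}}$. Let $(S_t)$ be $\mathbb R$-valued and $(V_t)$ be $[0,\infty)$-valued, both adapted. The process $(S_t,V_t)$ is *sub-$\psi$* if for every $\lambda\in[0,\lambda_{\max})$ there is a nonnegative supermartingale $(L_t^\lambda)$ with respect to $(\mathcal F_t)$ such that $\mathbb E[L_0^\lambda]\le 1$ and, for all $t\ge 0$, almost surely $$\exp\{\lambda S_t-\psi(\lambda)V_t\}\le L_t^\lambda .$$ For $d\ge1$, let $(S_t)$ be $\mathbb R^d$-valued and let $(V_t)$ take values in the symmetric positive semidefinite $d\times d$ matrices, both adapted. The process $(S_t,V_t)$ is *sub-$\psi$* if $(\langle\nu,S_t\rangle,\langle\nu,V_t\nu\rangle)_{t\ge0}$ is sub-$\psi$ in the scalar sense for every $\nu\in\mathbb R^d$ with $\|\nu\|=1$.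 Write $\gamma_{\max}(V)$ and $\gamma_{\min}(V)$ for the largest and smallest eigenvalue of $V$, and $\kappa(V)=\gamma_{\max}(V)/\gamma_{\min}(V)$. All norms are Euclidean. **Corollary.** Let $d\ge 1$, let $\psi:[0,\lambda_{\max})\to[0,\infty)$ be CGF-like, and let $(S_t,V_t)_{t\ge0}$ be an $\mathbb R^d$-valued sub-$\psi$ process. Suppose that (a) $\psi(\lambda)\sim\lambda^2/2$ as $\lambda\downarrow0$; (b) $\gamma_{\min}(V_t)\to\infty$ as $t\to\infty$, almost surely; (c) $\log(\gamma_{\max}(V_t))/\gamma_{\min}(V_t)\to0$ as $t\to\infty$, almost surely. Then, almost surely, $$\limsup_{t\to\infty}\frac{\|V_t^{-1/2}S_t\|}{\sqrt{2\log\log\gamma_{\max}(V_t)+d\log\kappa(V_t)}}\le 1 .$$ (By (b), almost surely $V_t$ is invertible and the denominator is well defined and positive for all large $t$.) -/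

import Mathlib

open MeasureTheory ProbabilityTheory Filter Topology Asymptotics

/-- The half-open interval `[0, lmax)` of real numbers, where `lmax` may be `⊤`. -/
def cgfDomain (lmax : EReal) : Set ℝ := {l : ℝ | 0 ≤ l ∧ (l : EReal) < lmax}

/-- `ψ : [0, lmax) → [0, ∞)` is CGF-like: twice continuously differentiable (one-sidedly at the
end point `0`), strictly convex, with `ψ 0 = ψ' 0 = 0` and `ψ'' 0 > 0`.  Only the values of `ψ`
on `[0, lmax)` play a role. -/
structure IsCGFLike (lmax : EReal) (ψ : ℝ → ℝ) : Prop where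
  lmax_pos : 0 < lmax
  nonneg : ∀ l ∈ cgfDomain lmax, 0 ≤ ψ l
  contDiffOn : ContDiffOn ℝ 2 ψ (cgfDomain lmax)
  strictConvexOn : StrictConvexOn ℝ (cgfDomain lmax) ψ
  map_zero : ψ 0 = 0
  deriv_zero : derivWithin ψ (cgfDomain lmax) 0 = 0
  deriv_two_pos : 0 < iteratedDerivWithin 2 ψ (cgfDomain lmax) 0

/-- The scalar sub-`ψ` condition: `S` is real-valued, `V` is nonnegative, both are adapted to `ℱ`,
and for every `l ∈ [0, lmax)` the process `exp (l * S t - ψ l * V t)` is almost surely dominated by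
a nonnegative supermartingale `L` of initial mean at most one. -/
structure IsSubPsi {Ω : Type*} {m0 : MeasurableSpace Ω} (μ : Measure Ω) (ℱ : Filtration ℕ m0)
    (lmax : EReal) (ψ : ℝ → ℝ) (S V : ℕ → Ω → ℝ) : Prop where
  adapted_S : StronglyAdapted ℱ S
  adapted_V : StronglyAdapted ℱ V
  nonneg_V : ∀ t ω, 0 ≤ V t ω
  exists_supermartingale : ∀ l ∈ cgfDomain lmax, ∃ L : ℕ → Ω → ℝ,
    Supermartingale L ℱ μ ∧ (∀ t, ∀ᵐ ω ∂μ, 0 ≤ L t ω) ∧ ∫ ω, L 0 ω ∂μ ≤ 1 ∧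
      ∀ t, ∀ᵐ ω ∂μ, Real.exp (l * S t ω - ψ l * V t ω) ≤ L t ω

/-- The matrix `A` acting on the Euclidean vector `x`. -/
def matAct {d : ℕ} (A : Matrix (Fin d) (Fin d) ℝ) (x : EuclideanSpace ℝ (Fin d)) :
    EuclideanSpace ℝ (Fin d) :=
  WithLp.toLp 2 (A.mulVec x.ofLp)

/-- The vector sub-`ψ` condition: `S` is `ℝ^d`-valued, `V` takes values in the positive
semidefinite matrices, both are adapted to `ℱ`, and for every unit vector `ν` the projected process
`(⟨ν, S t⟩, ⟨ν, V t ν⟩)` is sub-`ψ` in the scalar sense. -/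
structure IsVectorSubPsi {Ω : Type*} {m0 : MeasurableSpace Ω} (μ : Measure Ω)
    (ℱ : Filtration ℕ m0) (lmax : EReal) (ψ : ℝ → ℝ) {d : ℕ}
    (S : ℕ → Ω → EuclideanSpace ℝ (Fin d)) (V : ℕ → Ω → Matrix (Fin d) (Fin d) ℝ) : Prop where
  adapted_S : StronglyAdapted ℱ S
  adapted_V : StronglyAdapted ℱ V
  posSemidef_V : ∀ t ω, (V t ω).PosSemidef
  subPsi : ∀ ν : EuclideanSpace ℝ (Fin d), ‖ν‖ = 1 →
    IsSubPsi μ ℱ lmax ψ (fun t ω => inner ℝ ν (S t ω))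
      (fun t ω => inner ℝ ν (matAct (V t ω) ν))

/-- Largest eigenvalue of a symmetric matrix (of size at least one). -/
noncomputable def gammaMax {d : ℕ} (A : Matrix (Fin d) (Fin d) ℝ) : ℝ := sSup (spectrum ℝ A)

/-- Smallest eigenvalue of a symmetric matrix (of size at least one). -/
noncomputable def gammaMin {d : ℕ} (A : Matrix (Fin d) (Fin d) ℝ) : ℝ := sInf (spectrum ℝ A)

/-- Condition number of a positive definite matrix. -/
noncomputable def condNumber {d : ℕ} (A : Matrix (Fin d) (Fin d) ℝ) : ℝ := gammaMax A / gammaMin A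

/-- The inverse square root `∑ γ_n ^ (-1/2) v_n v_nᵀ` of a positive definite matrix with
spectral decomposition `∑ γ_n v_n v_nᵀ`. -/
noncomputable def invSqrt {d : ℕ} (A : Matrix (Fin d) (Fin d) ℝ) : Matrix (Fin d) (Fin d) ℝ :=
  cfc (fun x : ℝ => (√x)⁻¹) A

/-! The norm of `V^(-1/2) S` is the supremum of `⟨ν, S⟩ / √⟨ν, V ν⟩` over unit `ν`, so it suffices
to control a fine net of directions (`norm_invSqrt_le_of_net`). A mesh of order `κ^(-1/2)` is fine
enough, and such a net has order `κ^(d/2)` points; this produces the term `d log κ`.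

Both scales are discretised: `k` is the integer part of `log κ`, and `(1+e)^j` approximates the
variance in the given direction. For each `(k, j)` Ville's inequality bounds by `exp(-l)` the chance
that a net direction ever crosses a line of level `l = (1+e)(log j + kd/2)`. Times the net size `C
exp(kd/2)` this is summable over all pairs, so by Borel–Cantelli no crossing occurs once `j` is
large (`IsVectorSubPsi.ae_exists_forall_not_crossing`). Since `γ_min → ∞`, eventually every
direction has large `j`; since `log γ_max / γ_min → 0`, the slopes used tend to `0`, where `ψ(λ) ≤
(1+e) λ²/2`. The resulting bound is `(1+e)^4 / (1-e)`, and `e → 0`. -/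

/-! ### Maximal inequalities for supermartingales. -/

/-- **Ville's inequality**, finite horizon. -/
theorem ville_finite {Ω : Type*} {m0 : MeasurableSpace Ω} {μ : Measure Ω} [IsFiniteMeasure μ]
    {ℱ : Filtration ℕ m0} {L : ℕ → Ω → ℝ} (hL : Supermartingale L ℱ μ)
    (h0 : ∀ t, ∀ᵐ ω ∂μ, 0 ≤ L t ω) (a : ℝ) (n : ℕ) :
    a * μ.real {ω | ∃ t ≤ n, a ≤ L t ω} ≤ ∫ ω, L 0 ω ∂μ := by
  have hτ : IsStoppingTime ℱ (fun ω => ((hittingBtwn L (Set.Ici a) 0 n ω : ℕ) : ℕ∞)) :=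
    hL.stronglyAdapted.adapted.isStoppingTime_hittingBtwn measurableSet_Ici
  have hbdd : ∀ ω, ((hittingBtwn L (Set.Ici a) 0 n ω : ℕ) : ℕ∞) ≤ (n : ℕ) := fun ω => by
    exact Nat.cast_le.2 (hittingBtwn_le (u := L) (s := Set.Ici a) (n := 0) ω)
  -- Optional stopping for the submartingale `-L` at the first entry into `[a, ∞)`, capped at `n`;
  -- Markov's inequality then applies to the stopped value.
  have hmono := hL.neg.expected_stoppedValue_mono (isStoppingTime_const ℱ 0) hτ
    (fun ω => zero_le) hbdd
  have hint := hL.neg.integrable_stoppedValue hτ hbdd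
  set τ : Ω → ℕ∞ := fun ω => ((hittingBtwn L (Set.Ici a) 0 n ω : ℕ) : ℕ∞)
  replace hint : Integrable (-stoppedValue L τ) μ := hint
  replace hmono : ∫ ω, -L 0 ω ∂μ ≤ ∫ ω, -stoppedValue L τ ω ∂μ := hmono
  rw [integral_neg, integral_neg, neg_le_neg_iff] at hmono
  have hint' : Integrable (stoppedValue L τ) μ := by simpa using hint.neg
  have hpos : 0 ≤ᵐ[μ] stoppedValue L τ := by
    filter_upwards [ae_all_iff.2 h0] with ω hω
    exact hω _
  have hmk := mul_meas_ge_le_integral_of_nonneg hpos hint' a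
  rcases le_or_gt a 0 with ha | ha
  · exact (mul_nonpos_of_nonpos_of_nonneg ha measureReal_nonneg).trans
      (integral_nonneg_of_ae (h0 0))
  refine (mul_le_mul_of_nonneg_left (measureReal_mono ?_) ha.le).trans (hmk.trans hmono)
  rintro ω ⟨t, ht, hat⟩
  exact stoppedValue_hittingBtwn_mem (u := L) (s := Set.Ici a) ⟨t, ⟨Nat.zero_le _, ht⟩, hat⟩

/-- **Ville's inequality** for nonnegative supermartingales. -/
theorem ville {Ω : Type*} {m0 : MeasurableSpace Ω} {μ : Measure Ω} [IsFiniteMeasure μ]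
    {ℱ : Filtration ℕ m0} {L : ℕ → Ω → ℝ} (hL : Supermartingale L ℱ μ)
    (h0 : ∀ t, ∀ᵐ ω ∂μ, 0 ≤ L t ω) {a : ℝ} (ha : 0 < a) :
    μ {ω | ∃ t, a ≤ L t ω} ≤ ENNReal.ofReal ((∫ ω, L 0 ω ∂μ) / a) := by
  have hU : {ω | ∃ t, a ≤ L t ω} = ⋃ n : ℕ, {ω | ∃ t ≤ n, a ≤ L t ω} := by
    ext ω
    simp only [Set.mem_ofPred_eq, Set.mem_iUnion]
    exact ⟨fun ⟨t, h⟩ => ⟨t, t, le_rfl, h⟩, fun ⟨_, t, _, h⟩ => ⟨t, h⟩⟩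
  have hm : Monotone fun n : ℕ => {ω | ∃ t ≤ n, a ≤ L t ω} :=
    fun n m hnm ω ⟨t, ht, h⟩ => ⟨t, ht.trans hnm, h⟩
  rw [hU, hm.measure_iUnion]
  refine iSup_le fun n => ?_
  rw [← ENNReal.ofReal_toReal (measure_ne_top μ _)]
  refine ENNReal.ofReal_le_ofReal ?_
  rw [le_div_iff₀ ha, mul_comm]
  exact ville_finite hL h0 a n

/-- Line-crossing inequality for a scalar sub-`ψ` process. -/
theorem IsSubPsi.measure_crossing_le {Ω : Type*} {m0 : MeasurableSpace Ω} {μ : Measure Ω}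
    [IsFiniteMeasure μ] {ℱ : Filtration ℕ m0} {lmax : EReal} {ψ : ℝ → ℝ} {S V : ℕ → Ω → ℝ}
    (h : IsSubPsi μ ℱ lmax ψ S V) {l : ℝ} (hl : l ∈ cgfDomain lmax) (x : ℝ) :
    μ {ω | ∃ t, x ≤ l * S t ω - ψ l * V t ω} ≤ ENNReal.ofReal (Real.exp (-x)) := by
  obtain ⟨L, hL, h0, h1, hle⟩ := h.exists_supermartingale l hl
  calc μ {ω | ∃ t, x ≤ l * S t ω - ψ l * V t ω}
      ≤ μ {ω | ∃ t, Real.exp x ≤ L t ω} := by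
        refine measure_mono_ae ?_
        filter_upwards [ae_all_iff.2 hle] with ω hω
        rintro ⟨t, ht⟩
        exact ⟨t, (Real.exp_le_exp.2 ht).trans (hω t)⟩
    _ ≤ _ := ville hL h0 (Real.exp_pos x)
    _ ≤ _ := by
        refine ENNReal.ofReal_le_ofReal ?_
        rw [Real.exp_neg, div_eq_mul_inv]
        exact mul_le_of_le_one_left (by positivity) h1

/-! ### Nets of the sphere. -/

/-- Finite nets of the Euclidean unit sphere, consisting of unit vectors. -/
theorem exists_sphere_net (d : ℕ) : ∃ C : ℝ, 0 < C ∧ ∀ r : ℝ, 0 < r → r ≤ 1 →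
    ∃ F : Finset (EuclideanSpace ℝ (Fin d)), (∀ x ∈ F, ‖x‖ = 1) ∧ (F.card : ℝ) ≤ C * (1 / r) ^ d ∧
      ∀ ν : EuclideanSpace ℝ (Fin d), ‖ν‖ = 1 → ∃ x ∈ F, ‖ν - x‖ ≤ r := by
  classical
  refine ⟨(3 * (d + 2)) ^ d, by positivity, fun r hr hr1 => ?_⟩
  -- Cells of side `1/m` have diameter at most `d/m ≤ r`; the `+ 1` keeps `m` positive when `d = 0`.
  set m : ℕ := ⌈(d : ℝ) / r⌉₊ + 1 with hm
  have hm1 : (d : ℝ) / r ≤ m := (Nat.le_ceil _).trans (by rw [hm]; push_cast; linarith)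
  have hmpos : (0 : ℝ) < m := by rw [hm]; positivity
  have hm2 : (m : ℝ) ≤ (d + 2) / r := by
    have h1 := (Nat.ceil_lt_add_one (show (0 : ℝ) ≤ (d : ℝ) / r by positivity)).le
    have h2 : 1 ≤ 1 / r := by rw [le_div_iff₀ hr]; linarith
    have h3 : ((d : ℝ) + 2) / r = d / r + 2 * (1 / r) := by ring
    rw [hm, h3]; push_cast; linarith
  -- One unit vector is picked in each cell that meets the sphere: the sub-`ψ` condition speaks only
  -- of unit directions, so grid points would not do.
  let g : EuclideanSpace ℝ (Fin d) → (Fin d → ℤ) := fun ν i => ⌊ν i * m⌋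
  let G : Finset (Fin d → ℤ) :=
    {c ∈ Fintype.piFinset fun _ => Finset.Icc (-(m : ℤ)) m | ∃ ν, ‖ν‖ = 1 ∧ g ν = c}
  have hG : ∀ c : G, ∃ ν, ‖ν‖ = 1 ∧ g ν = c := fun c => (Finset.mem_filter.1 c.2).2
  choose rep hrep1 hrep2 using hG
  refine ⟨Finset.univ.image rep, ?_, ?_, ?_⟩
  · intro x hx
    obtain ⟨c, -, rfl⟩ := Finset.mem_image.1 hx
    exact hrep1 c
  · have h1 : (Finset.univ.image rep).card ≤ (2 * m + 1) ^ d := by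
      refine Finset.card_image_le.trans ?_
      rw [Finset.card_univ, Fintype.card_coe]
      refine (Finset.card_filter_le _ _).trans ?_
      rw [Fintype.card_piFinset]
      simp only [Int.card_Icc, Finset.prod_const, Finset.card_univ, Fintype.card_fin]
      refine Nat.pow_le_pow_left ?_ _
      omega
    have hm0 : (1 : ℝ) ≤ m := by exact_mod_cast Nat.le_add_left 1 _
    calc ((Finset.univ.image rep).card : ℝ) ≤ (2 * m + 1) ^ d := by exact_mod_cast h1
      _ ≤ (3 * ((d + 2) / r)) ^ d := by gcongr; linarith
      _ = _ := by rw [← mul_pow]; ring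
  · intro ν hν
    have habs : ∀ i, |ν i| ≤ 1 := fun i => by
      have := PiLp.norm_apply_le ν i
      rwa [hν, Real.norm_eq_abs] at this
    have hmem : g ν ∈ G := by
      refine Finset.mem_filter.2 ⟨Fintype.mem_piFinset.2 fun i => ?_, ν, hν, rfl⟩
      have := abs_le.1 (habs i)
      rw [Finset.mem_Icc]
      constructor
      · rw [Int.le_floor]; push_cast; nlinarith
      · have : (⌊ν i * m⌋ : ℝ) ≤ m := (Int.floor_le _).trans (by nlinarith)
        exact_mod_cast this
    refine ⟨rep ⟨g ν, hmem⟩, Finset.mem_image_of_mem _ (Finset.mem_univ _), ?_⟩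
    set x := rep ⟨g ν, hmem⟩
    have hx : g x = g ν := hrep2 ⟨g ν, hmem⟩
    have hcoord : ∀ i, |(ν - x) i| ≤ 1 / m := fun i => by
      have h1 : ⌊ν i * m⌋ = ⌊x i * m⌋ := (congrFun hx i).symm
      have h2 := Int.abs_sub_lt_one_of_floor_eq_floor h1
      rw [← sub_mul, abs_mul, abs_of_pos hmpos] at h2
      rw [le_div_iff₀ hmpos]
      exact h2.le
    calc ‖ν - x‖ = √(∑ i, ‖(ν - x) i‖ ^ 2) := EuclideanSpace.norm_eq _
      _ ≤ √(∑ i : Fin d, (1 / (m : ℝ)) ^ 2) := by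
          refine Real.sqrt_le_sqrt (Finset.sum_le_sum fun i _ => ?_)
          exact pow_le_pow_left₀ (norm_nonneg _) (hcoord i) 2
      _ = √(d * (1 / (m : ℝ)) ^ 2) := by simp
      _ ≤ √((d * (1 / (m : ℝ))) ^ 2) := by
          refine Real.sqrt_le_sqrt ?_
          rw [mul_pow]
          gcongr
          exact_mod_cast Nat.le_self_pow (two_ne_zero) d
      _ = d * (1 / (m : ℝ)) := Real.sqrt_sq (by positivity)
      _ ≤ r := by
          rw [mul_one_div, div_le_iff₀ hmpos]
          rwa [div_le_iff₀ hr, mul_comm] at hm1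

/-! ### Matrices acting on Euclidean space. -/

section MatAct

variable {d : ℕ}

theorem matAct_mul (A B : Matrix (Fin d) (Fin d) ℝ) (x : EuclideanSpace ℝ (Fin d)) :
    matAct (A * B) x = matAct A (matAct B x) := by
  simp [matAct, Matrix.mulVec_mulVec]

theorem matAct_one (x : EuclideanSpace ℝ (Fin d)) : matAct 1 x = x := by
  simp [matAct]

theorem matAct_matrix_sub (A B : Matrix (Fin d) (Fin d) ℝ) (x : EuclideanSpace ℝ (Fin d)) :
    matAct (A - B) x = matAct A x - matAct B x := by
  simp [matAct, Matrix.sub_mulVec]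

theorem matAct_sub (A : Matrix (Fin d) (Fin d) ℝ) (x y : EuclideanSpace ℝ (Fin d)) :
    matAct A (x - y) = matAct A x - matAct A y := by
  simp [matAct, Matrix.mulVec_sub]

theorem matAct_smul (A : Matrix (Fin d) (Fin d) ℝ) (c : ℝ) (x : EuclideanSpace ℝ (Fin d)) :
    matAct A (c • x) = c • matAct A x := by
  simp [matAct, Matrix.mulVec_smul]

theorem matAct_algebraMap (c : ℝ) (x : EuclideanSpace ℝ (Fin d)) :
    matAct (algebraMap ℝ _ c) x = c • x := by
  simp [matAct, Algebra.algebraMap_eq_smul_one, Matrix.smul_mulVec]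

theorem inner_eq_dotProduct (x y : EuclideanSpace ℝ (Fin d)) :
    inner ℝ x y = x.ofLp ⬝ᵥ y.ofLp := by
  rw [EuclideanSpace.inner_eq_star_dotProduct, dotProduct_comm]; simp

theorem inner_matAct_comm {A : Matrix (Fin d) (Fin d) ℝ} (hA : A.IsHermitian)
    (x y : EuclideanSpace ℝ (Fin d)) : inner ℝ (matAct A x) y = inner ℝ x (matAct A y) := by
  rw [inner_eq_dotProduct, inner_eq_dotProduct]
  simp only [matAct]
  have hT : A.transpose = A := by
    rw [← Matrix.conjTranspose_eq_transpose_of_trivial]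
    exact hA
  rw [Matrix.dotProduct_mulVec, ← Matrix.mulVec_transpose, hT]

theorem inner_matAct_nonneg {A : Matrix (Fin d) (Fin d) ℝ} (hA : A.PosSemidef)
    (x : EuclideanSpace ℝ (Fin d)) : 0 ≤ inner ℝ x (matAct A x) := by
  rw [inner_eq_dotProduct]
  simpa [matAct] using hA.dotProduct_mulVec_nonneg x.ofLp

end MatAct

/-! ### Extreme eigenvalues, square roots and reduction to a net. -/

section Gamma

variable {d : ℕ} {A : Matrix (Fin d) (Fin d) ℝ}

theorem gammaMin_le_of_mem_spectrum {x : ℝ} (hx : x ∈ spectrum ℝ A) : gammaMin A ≤ x :=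
  csInf_le (Matrix.finite_real_spectrum (𝕜 := ℝ)).bddBelow hx

theorem le_gammaMax_of_mem_spectrum {x : ℝ} (hx : x ∈ spectrum ℝ A) : x ≤ gammaMax A :=
  le_csSup (Matrix.finite_real_spectrum (𝕜 := ℝ)).bddAbove hx

theorem gammaMin_mul_sq_le (hA : A.IsHermitian) (x : EuclideanSpace ℝ (Fin d)) :
    gammaMin A * ‖x‖ ^ 2 ≤ inner ℝ x (matAct A x) := by
  have hP : (A - algebraMap ℝ _ (gammaMin A)).PosSemidef := by
    rw [Matrix.posSemidef_iff_isHermitian_and_spectrum_nonneg]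
    refine ⟨hA.sub (by simp [Matrix.IsHermitian, Algebra.algebraMap_eq_smul_one]), ?_⟩
    intro y hy
    rw [← spectrum.sub_singleton_eq] at hy
    obtain ⟨z, hz, w, rfl, rfl⟩ := hy
    exact sub_nonneg.2 (gammaMin_le_of_mem_spectrum hz)
  have := inner_matAct_nonneg hP x
  rw [matAct_matrix_sub, matAct_algebraMap, inner_sub_right, inner_smul_right,
    real_inner_self_eq_norm_sq] at this
  linarith

theorem inner_matAct_le_gammaMax_mul_sq (hA : A.IsHermitian) (x : EuclideanSpace ℝ (Fin d)) :
    inner ℝ x (matAct A x) ≤ gammaMax A * ‖x‖ ^ 2 := by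
  have hP : (algebraMap ℝ _ (gammaMax A) - A).PosSemidef := by
    rw [Matrix.posSemidef_iff_isHermitian_and_spectrum_nonneg]
    refine ⟨Matrix.IsHermitian.sub
      (by simp [Matrix.IsHermitian, Algebra.algebraMap_eq_smul_one]) hA, ?_⟩
    intro y hy
    rw [← spectrum.singleton_sub_eq] at hy
    obtain ⟨w, rfl, z, hz, rfl⟩ := hy
    exact sub_nonneg.2 (le_gammaMax_of_mem_spectrum hz)
  have := inner_matAct_nonneg hP x
  rw [matAct_matrix_sub, matAct_algebraMap, inner_sub_right, inner_smul_right,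
    real_inner_self_eq_norm_sq] at this
  linarith

theorem gammaMin_le_gammaMax (hd : 1 ≤ d) (hA : A.IsHermitian) : gammaMin A ≤ gammaMax A := by
  have : Nonempty (Fin d) := ⟨⟨0, hd⟩⟩
  have h := hA.eigenvalues_mem_spectrum_real ⟨0, hd⟩
  exact (gammaMin_le_of_mem_spectrum h).trans (le_gammaMax_of_mem_spectrum h)

/-- The spectrum is finite, so every function is continuous on it, and positive, so the pointwise
identities for `√x` and `(√x)⁻¹` transfer to `A`. -/
theorem exists_sqrt_invSqrt (hA : A.IsHermitian) (hmin : 0 < gammaMin A) :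
    ∃ R : Matrix (Fin d) (Fin d) ℝ, R.IsHermitian ∧ (invSqrt A).IsHermitian ∧
      R * R = A ∧ R * invSqrt A = 1 := by
  have hfin : (spectrum ℝ A).Finite := Matrix.finite_real_spectrum (𝕜 := ℝ)
  have hpos : ∀ x ∈ spectrum ℝ A, 0 < x := fun x hx => hmin.trans_le (gammaMin_le_of_mem_spectrum hx)
  have hsa : IsSelfAdjoint A := hA
  refine ⟨cfc (fun x : ℝ => √x) A, cfc_predicate (R := ℝ) (p := IsSelfAdjoint) _ A,
    cfc_predicate (R := ℝ) (p := IsSelfAdjoint) _ A, ?_, ?_⟩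
  · rw [← cfc_mul _ _ A (hfin.continuousOn _) (hfin.continuousOn _)]
    conv_rhs => rw [← cfc_id ℝ A hsa]
    refine cfc_congr fun x hx => ?_
    simp [Real.mul_self_sqrt (hpos x hx).le]
  · rw [invSqrt, ← cfc_mul _ _ A (hfin.continuousOn _) (hfin.continuousOn _), ← cfc_one ℝ A hsa]
    refine cfc_congr fun x hx => ?_
    have := (Real.sqrt_pos.2 (hpos x hx)).ne'
    simp [this]

/-- If `⟨p, s⟩ ≤ M √⟨p, A p⟩` on a net of the unit sphere that is fine enough relative to the
condition number of `A`, then `‖A ^ (-1/2) s‖` is at most `M` up to a factor close to one. -/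
theorem norm_invSqrt_le_of_net (hA : A.IsHermitian) (hmin : 0 < gammaMin A)
    {F : Set (EuclideanSpace ℝ (Fin d))} {r e M : ℝ} (hr : 0 ≤ r) (hM : 0 ≤ M) (he : 0 ≤ e)
    (hnet : ∀ ν : EuclideanSpace ℝ (Fin d), ‖ν‖ = 1 → ∃ x ∈ F, ‖ν - x‖ ≤ r)
    (hre : r * √(condNumber A) ≤ e) {s : EuclideanSpace ℝ (Fin d)}
    (hs : ∀ x ∈ F, inner ℝ x s ≤ M * √(inner ℝ x (matAct A x))) :
    ‖matAct (invSqrt A) s‖ * (1 - e) ≤ M * (1 + e) := by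
  obtain ⟨R, hR, -, hRR, hRB⟩ := exists_sqrt_invSqrt hA hmin
  set B := invSqrt A
  set x := matAct B s with hx
  have hsx : s = matAct R x := by rw [hx, ← matAct_mul, hRB, matAct_one]
  have hq : ∀ y, √(inner ℝ y (matAct A y)) = ‖matAct R y‖ := fun y => by
    rw [← hRR, matAct_mul, ← inner_matAct_comm hR, real_inner_self_eq_norm_sq,
      Real.sqrt_sq (norm_nonneg _)]
  rcases eq_or_ne x 0 with h0 | h0
  · rw [h0, norm_zero, zero_mul]; positivity
  -- `w = A⁻¹ s` is the maximising direction: `R w` is parallel to `x`, so Cauchy–Schwarz is an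
  -- equality there.
  set w := matAct B x with hw
  have hRw : matAct R w = x := by rw [hw, ← matAct_mul, hRB, matAct_one]
  have hw0 : w ≠ 0 := by
    intro h
    rw [h] at hRw
    exact h0 (by rw [← hRw]; simp [matAct])
  have hwpos := norm_pos_iff.2 hw0
  set ν := ‖w‖⁻¹ • w with hν
  have hν1 : ‖ν‖ = 1 := by rw [hν, norm_smul, norm_inv, norm_norm, inv_mul_cancel₀ hwpos.ne']
  have hRν : matAct R ν = ‖w‖⁻¹ • x := by rw [hν, matAct_smul, hRw]
  obtain ⟨p, hp, hpr⟩ := hnet ν hν1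
  have hmax : 0 ≤ gammaMax A := by
    have h1 := gammaMin_mul_sq_le hA ν
    have h2 := inner_matAct_le_gammaMax_mul_sq hA ν
    rw [hν1] at h1 h2
    nlinarith
  -- Moving to the net costs at most `r √γ_max = r √κ √γ_min`, while `‖R ν‖ ≥ √γ_min`.
  have hdiff : ‖matAct R (ν - p)‖ ≤ e * ‖matAct R ν‖ := by
    have h1 : ‖matAct R (ν - p)‖ ≤ √(gammaMax A) * r := by
      rw [← hq]
      calc √(inner ℝ (ν - p) (matAct A (ν - p))) ≤ √(gammaMax A * r ^ 2) := by
            refine Real.sqrt_le_sqrt ((inner_matAct_le_gammaMax_mul_sq hA _).trans ?_)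
            gcongr
        _ = _ := by rw [Real.sqrt_mul hmax, Real.sqrt_sq hr]
    have h2 : √(gammaMin A) ≤ ‖matAct R ν‖ := by
      rw [← hq]
      refine Real.sqrt_le_sqrt ?_
      simpa [hν1] using gammaMin_mul_sq_le hA ν
    have h3 : √(gammaMax A) = √(condNumber A) * √(gammaMin A) := by
      rw [condNumber, ← Real.sqrt_mul (div_nonneg hmax hmin.le), div_mul_cancel₀ _ hmin.ne']
    calc ‖matAct R (ν - p)‖ ≤ √(gammaMax A) * r := h1
      _ = (r * √(condNumber A)) * √(gammaMin A) := by rw [h3]; ring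
      _ ≤ e * ‖matAct R ν‖ := by gcongr
  have hpq : ‖matAct R p‖ ≤ ‖matAct R ν‖ + ‖matAct R (ν - p)‖ := by
    have : matAct R p = matAct R ν - matAct R (ν - p) := by rw [matAct_sub]; abel
    rw [this]; exact norm_sub_le _ _
  have hsp := hs p hp
  rw [hq] at hsp
  have hinner : inner ℝ (matAct R ν) x = ‖x‖ * ‖matAct R ν‖ := by
    rw [hRν, real_inner_smul_left, real_inner_self_eq_norm_sq, norm_smul, norm_inv, norm_norm]; ring
  have hdec : inner ℝ (matAct R ν) x = inner ℝ p s + inner ℝ (matAct R (ν - p)) x := by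
    rw [hsx, ← inner_matAct_comm hR, ← inner_add_left, matAct_sub]; congr 1; abel
  have hcs := real_inner_le_norm (matAct R (ν - p)) x
  have hν0 : 0 < ‖matAct R ν‖ := by
    rw [hRν, norm_smul, norm_inv, norm_norm]
    exact mul_pos (inv_pos.2 hwpos) (norm_pos_iff.2 h0)
  have hkey : ‖x‖ * ‖matAct R ν‖ ≤ (M * (1 + e) + e * ‖x‖) * ‖matAct R ν‖ := by
    rw [← hinner, hdec]
    have h1 : M * ‖matAct R p‖ ≤ M * ((1 + e) * ‖matAct R ν‖) := by gcongr; linarith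
    have h2 : ‖matAct R (ν - p)‖ * ‖x‖ ≤ e * ‖matAct R ν‖ * ‖x‖ := by gcongr
    nlinarith
  have := le_of_mul_le_mul_right hkey hν0
  linarith

end Gamma

/-! ### Calibration of levels and slopes. -/

/-- The level of the line crossed on the scale of index `j` (size of the variance) and `k`
(logarithm of the condition number). -/
noncomputable def crossLevel (e : ℝ) (d k j : ℕ) : ℝ := (1 + e) * (Real.log j + k * d / 2)

/-- The slope parameter `l` belonging to `crossLevel`. -/
noncomputable def crossSlope (e : ℝ) (d k j : ℕ) : ℝ := √(2 * crossLevel e d k j / (1 + e) ^ j)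

/-- The factor `1 + e` in the level leaves, after the net size `exp(kd/2)` is absorbed, a geometric
series in `k` of ratio `exp(-ed/2)` times `∑ j^(-(1+e))`. -/
theorem summable_exp_neg_crossLevel {e : ℝ} (he : 0 < e) {d : ℕ} (hd : 1 ≤ d) :
    Summable fun p : ℕ × ℕ =>
      Real.exp (p.1 * d / 2) * Real.exp (-crossLevel e d p.1 p.2) := by
  have h1 : Summable fun k : ℕ => Real.exp (-(e * d / 2)) ^ k := by
    refine summable_geometric_of_lt_one (Real.exp_pos _).le ?_
    rw [Real.exp_lt_one_iff, neg_lt_zero]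
    have : (0 : ℝ) < d := by exact_mod_cast hd
    positivity
  have h2 : Summable fun j : ℕ => Real.exp (-((1 + e) * Real.log j)) := by
    -- Since `Real.log 0 = 0`, the term at `j = 0` is `1` and not a power of `j`; it is dropped.
    rw [← summable_nat_add_iff 1]
    have h3 := (summable_nat_add_iff 1).2
      ((Real.summable_nat_rpow (p := -(1 + e))).2 (by linarith))
    refine h3.congr fun j => ?_
    rw [Real.rpow_def_of_pos (by positivity)]
    congr 1
    ring
  refine (h1.mul_of_nonneg h2 (fun _ => by positivity) fun _ => by positivity).congr fun p => ?_
  rw [← Real.exp_nat_mul, ← Real.exp_add, ← Real.exp_add, crossLevel]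
  congr 1
  ring

/-- Not crossing a line of slope tuned to the scale `p` of the variance bounds the process. -/
theorem le_of_not_crossing {e l p v s c : ℝ} (he : 0 ≤ e) (hl : 0 < l) (hp : 0 < p)
    (hpv : p ≤ v) (hvp : v ≤ (1 + e) * p) (hc : c ≤ (1 + e) * (√(2 * l / p) ^ 2 / 2))
    (hs : √(2 * l / p) * s - c * v < l) : s ≤ (1 + e) ^ 2 * √(2 * l) * √v := by
  have hlp : 0 < 2 * l / p := by positivity
  have hpos := Real.sqrt_pos.2 hlp
  have hv : 0 < v := hp.trans_le hpv
  rw [Real.sq_sqrt hlp.le] at hc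
  have h1 : c * v ≤ (1 + e) ^ 2 * l := by
    calc c * v ≤ (1 + e) * (2 * l / p / 2) * ((1 + e) * p) :=
          mul_le_mul hc hvp hv.le (by positivity)
      _ = _ := by field_simp
  -- The slope balances the level `l` against the variance cost `c v`, which is also about `l`;
  -- hence `2 * l`.
  have h2 : √(2 * l / p) * s ≤ (1 + e) ^ 2 * (2 * l) := by
    nlinarith [mul_nonneg he hl.le, mul_nonneg (mul_nonneg he he) hl.le]
  have h3 : 2 * l ≤ √(2 * l / p) * (√(2 * l) * √v) := by
    calc 2 * l = √(2 * l) * √(2 * l) := (Real.mul_self_sqrt (by positivity)).symm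
      _ = √(2 * l) * (√(2 * l / p) * √p) := by
          rw [← Real.sqrt_mul hlp.le, div_mul_cancel₀ _ hp.ne']
      _ ≤ √(2 * l) * (√(2 * l / p) * √v) := by gcongr
      _ = _ := by ring
  refine le_of_mul_le_mul_left (h2.trans ?_) hpos
  calc (1 + e) ^ 2 * (2 * l) ≤ (1 + e) ^ 2 * (√(2 * l / p) * (√(2 * l) * √v)) := by gcongr
    _ = _ := by ring

/-- Here `a`, `b` stand for `γ_min`, `γ_max`. As `(1+e)^j ≤ b`, `log j` exceeds `log log b` by at
most the constant `-log log(1+e)`, which `hb` absorbs at the price of one factor `1 + e`. -/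
theorem two_mul_crossLevel_le {e a b : ℝ} {d k j : ℕ} (he : 0 < e) (ha : 1 ≤ a) (hab : a ≤ b)
    (hj : 2 ≤ j) (hjb : (1 + e) ^ j ≤ b) (hk : (k : ℝ) ≤ Real.log (b / a))
    (hb : -Real.log (Real.log (1 + e)) ≤ e * Real.log (Real.log b)) :
    2 * crossLevel e d k j ≤ (1 + e) ^ 2 * (2 * Real.log (Real.log b) + d * Real.log (b / a)) := by
  have hpos : 0 < Real.log (1 + e) := Real.log_pos (by linarith)
  have hj0 : (0 : ℝ) < j := by positivity
  have h1 : j * Real.log (1 + e) ≤ Real.log b := by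
    rw [← Real.log_pow]
    exact Real.log_le_log (by positivity) hjb
  have h2 : Real.log j + Real.log (Real.log (1 + e)) ≤ Real.log (Real.log b) := by
    rw [← Real.log_mul hj0.ne' hpos.ne']
    exact Real.log_le_log (by positivity) h1
  have h3 : (k : ℝ) * d ≤ d * Real.log (b / a) := by rw [mul_comm]; gcongr
  have h4 : 0 ≤ d * Real.log (b / a) :=
    mul_nonneg (Nat.cast_nonneg _) (Real.log_nonneg ((one_le_div (by linarith)).2 hab))
  have h5 : 2 * Real.log j + k * d ≤
      (1 + e) * (2 * Real.log (Real.log b) + d * Real.log (b / a)) := by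
    nlinarith [mul_nonneg he.le h4]
  calc 2 * crossLevel e d k j = (1 + e) * (2 * Real.log j + k * d) := by rw [crossLevel]; ring
    _ ≤ (1 + e) * ((1 + e) * (2 * Real.log (Real.log b) + d * Real.log (b / a))) := by gcongr
    _ = _ := by ring

theorem crossLevel_pos {e : ℝ} (he : 0 < e) {d k j : ℕ} (hj : 2 ≤ j) : 0 < crossLevel e d k j := by
  have : 0 < Real.log j := Real.log_pos (by exact_mod_cast hj)
  unfold crossLevel
  positivity

/-- The squared slope is at most a constant times `log γ_max / γ_min`; this is the use of hypothesis
(c). -/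
theorem crossSlope_lt {e a b l0 : ℝ} {d k j : ℕ} (he : 0 < e) (hl0 : 0 < l0) (ha : 1 ≤ a)
    (hab : a ≤ b) (hj : 2 ≤ j) (hjb : (1 + e) ^ j ≤ b) (haj : a ≤ (1 + e) ^ (j + 1))
    (hk : (k : ℝ) ≤ Real.log (b / a))
    (hb : -Real.log (Real.log (1 + e)) ≤ e * Real.log (Real.log b))
    (hsmall : (1 + e) ^ 3 * (2 + d) * (Real.log b / a) < l0 ^ 2) : crossSlope e d k j < l0 := by
  rw [crossSlope, Real.sqrt_lt' hl0]
  refine lt_of_le_of_lt ?_ hsmall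
  have ha0 : 0 < a := by linarith
  have hb0 : 0 < b := by linarith
  have hlb : 0 ≤ Real.log b := Real.log_nonneg (by linarith)
  have h1 : Real.log (Real.log b) ≤ Real.log b := Real.log_le_self hlb
  have h2 : Real.log (b / a) ≤ Real.log b :=
    Real.log_le_log (by positivity) (div_le_self hb0.le ha)
  have h3 : 2 * Real.log (Real.log b) + d * Real.log (b / a) ≤ (2 + d) * Real.log b := by
    have : d * Real.log (b / a) ≤ d * Real.log b := by gcongr
    linarith
  have h4 := two_mul_crossLevel_le (d := d) he ha hab hj hjb hk hb
  rw [div_le_iff₀ (by positivity)]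
  calc 2 * crossLevel e d k j
      ≤ (1 + e) ^ 2 * ((2 + d) * Real.log b) := h4.trans (by gcongr)
    _ = (1 + e) ^ 2 * (2 + d) * (Real.log b / a) * a := by field_simp
    _ ≤ (1 + e) ^ 2 * (2 + d) * (Real.log b / a) * (1 + e) ^ (j + 1) := by gcongr
    _ = _ := by ring

/-- Near `0`, a function equivalent to `l ^ 2 / 2` is at most `(1 + e) l ^ 2 / 2`. -/
theorem exists_forall_le_of_isEquivalent {lmax : EReal} {ψ : ℝ → ℝ} (hl : 0 < lmax)
    (hψ0 : ψ ~[𝓝[>] 0] fun l : ℝ => l ^ 2 / 2) {e : ℝ} (he : 0 < e) :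
    ∃ l0 > 0, ∀ l, 0 < l → l < l0 → l ∈ cgfDomain lmax ∧ ψ l ≤ (1 + e) * (l ^ 2 / 2) := by
  have h1 : ∀ᶠ l in 𝓝[>] (0 : ℝ), ψ l ≤ (1 + e) * (l ^ 2 / 2) := by
    filter_upwards [hψ0.isLittleO.def he] with l hl
    simp only [Pi.sub_apply, Real.norm_eq_abs] at hl
    rw [abs_of_nonneg (show 0 ≤ l ^ 2 / 2 by positivity)] at hl
    linarith [le_abs_self (ψ l - l ^ 2 / 2)]
  have h2 : ∀ᶠ l : ℝ in 𝓝[>] (0 : ℝ), Real.toEReal l < lmax := by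
    refine Filter.Eventually.filter_mono nhdsWithin_le_nhds ?_
    exact (continuous_coe_real_ereal.tendsto 0).eventually_lt_const (by simpa using hl)
  obtain ⟨u, hu, hsub⟩ := mem_nhdsGT_iff_exists_Ioo_subset.1 (h1.and h2)
  exact ⟨u, hu, fun l h0 hlu => ⟨⟨h0.le, (hsub ⟨h0, hlu⟩).2⟩, (hsub ⟨h0, hlu⟩).1⟩⟩

/-! ### Union bound, Borel–Cantelli and the pathwise bound. -/

section Crossing

variable {Ω : Type*} {m0 : MeasurableSpace Ω} {μ : Measure Ω} [IsProbabilityMeasure μ]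
  {ℱ : Filtration ℕ m0} {d : ℕ} {lmax : EReal} {ψ : ℝ → ℝ}
  {S : ℕ → Ω → EuclideanSpace ℝ (Fin d)} {V : ℕ → Ω → Matrix (Fin d) (Fin d) ℝ}

theorem IsVectorSubPsi.measure_crossing_le (hSV : IsVectorSubPsi μ ℱ lmax ψ S V)
    (F : Finset (EuclideanSpace ℝ (Fin d))) (hF : ∀ x ∈ F, ‖x‖ = 1) {l : ℝ}
    (hl : l ∈ cgfDomain lmax) (y : ℝ) :
    μ {ω | ∃ x ∈ F, ∃ t, y ≤ l * inner ℝ x (S t ω) - ψ l * inner ℝ x (matAct (V t ω) x)} ≤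
      ENNReal.ofReal (F.card * Real.exp (-y)) := by
  have hU : {ω | ∃ x ∈ F, ∃ t, y ≤ l * inner ℝ x (S t ω) - ψ l * inner ℝ x (matAct (V t ω) x)} =
      ⋃ x ∈ F, {ω | ∃ t, y ≤ l * inner ℝ x (S t ω) - ψ l * inner ℝ x (matAct (V t ω) x)} := by
    ext ω; simp
  rw [hU]
  refine (measure_biUnion_finset_le _ _).trans ?_
  refine (Finset.sum_le_card_nsmul _ _ _ fun x hx =>
    (hSV.subPsi x (hF x hx)).measure_crossing_le hl y).trans ?_
  rw [nsmul_eq_mul, ENNReal.ofReal_mul (Nat.cast_nonneg _), ENNReal.ofReal_natCast]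

/-- Almost surely, only finitely many scales of the variance see a line crossing in a direction of
the net attached to the condition number. -/
theorem IsVectorSubPsi.ae_exists_forall_not_crossing (hSV : IsVectorSubPsi μ ℱ lmax ψ S V)
    (hd : 1 ≤ d) {e l0 C : ℝ} (he : 0 < e) (hl0 : ∀ l, 0 < l → l < l0 → l ∈ cgfDomain lmax)
    (N : ℕ → Finset (EuclideanSpace ℝ (Fin d))) (hN : ∀ k, ∀ x ∈ N k, ‖x‖ = 1)
    (hcard : ∀ k, ((N k).card : ℝ) ≤ C * Real.exp (k * d / 2)) :
    ∀ᵐ ω ∂μ, ∃ J : ℕ, ∀ k j, J ≤ j → 0 < crossSlope e d k j → crossSlope e d k j < l0 →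
      ∀ x ∈ N k, ∀ t, crossSlope e d k j * inner ℝ x (S t ω) -
        ψ (crossSlope e d k j) * inner ℝ x (matAct (V t ω) x) < crossLevel e d k j := by
  -- With the slope condition inside the event, inadmissible pairs give the empty set and the sum
  -- runs over all of `ℕ × ℕ`.
  let A : ℕ × ℕ → Set Ω := fun p =>
    {ω | (0 < crossSlope e d p.1 p.2 ∧ crossSlope e d p.1 p.2 < l0) ∧
      ∃ x ∈ N p.1, ∃ t, crossLevel e d p.1 p.2 ≤ crossSlope e d p.1 p.2 * inner ℝ x (S t ω) -
        ψ (crossSlope e d p.1 p.2) * inner ℝ x (matAct (V t ω) x)}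
  have hA : ∀ p, μ (A p) ≤ ENNReal.ofReal
      (C * (Real.exp (p.1 * d / 2) * Real.exp (-crossLevel e d p.1 p.2))) := by
    intro p
    by_cases hp : 0 < crossSlope e d p.1 p.2 ∧ crossSlope e d p.1 p.2 < l0
    · refine (measure_mono fun ω hω => hω.2).trans
        ((hSV.measure_crossing_le (N p.1) (hN p.1) (hl0 _ hp.1 hp.2) _).trans ?_)
      refine ENNReal.ofReal_le_ofReal ?_
      rw [← mul_assoc]
      exact mul_le_mul_of_nonneg_right (hcard _) (Real.exp_pos _).le
    · have : A p = ∅ := Set.eq_empty_of_forall_notMem fun ω hω => hp hω.1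
      simp [this]
  have hsum : ∑' p, μ (A p) ≠ ⊤ := by
    refine ne_top_of_le_ne_top ?_ (ENNReal.tsum_le_tsum hA)
    exact ((summable_exp_neg_crossLevel he hd).mul_left C).tsum_ofReal_ne_top
  filter_upwards [ae_finite_setOfPred_mem hsum] with ω hω
  -- Finitely many pairs give a `J` uniform in `k`, as needed because `κ(V_t)` may vary freely with
  -- `t`.
  obtain ⟨J, hJ⟩ := (hω.image Prod.snd).bddAbove
  refine ⟨J + 1, fun k j hj h0 h1 x hx t => ?_⟩
  by_contra! hcon
  have : j ≤ J := hJ ⟨(k, j), ⟨⟨h0, h1⟩, x, hx, t, hcon⟩, rfl⟩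
  omega

/-- The mesh is chosen so that mesh times `√κ` is at most `e` whenever `log κ ≤ k + 1`. -/
theorem exists_nets (d : ℕ) {e : ℝ} (he : 0 < e) (he1 : e ≤ 1) :
    ∃ (C : ℝ) (N : ℕ → Finset (EuclideanSpace ℝ (Fin d))), (∀ k, ∀ x ∈ N k, ‖x‖ = 1) ∧
      (∀ k, ((N k).card : ℝ) ≤ C * Real.exp (k * d / 2)) ∧
      ∀ k, ∀ ν : EuclideanSpace ℝ (Fin d), ‖ν‖ = 1 →
        ∃ x ∈ N k, ‖ν - x‖ ≤ e * Real.exp (-((k + 1) / 2)) := by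
  obtain ⟨C, hC, h⟩ := exists_sphere_net d
  have hr : ∀ k : ℕ, e * Real.exp (-(((k : ℝ) + 1) / 2)) ≤ 1 := fun k => by
    refine mul_le_one₀ he1 (Real.exp_pos _).le (Real.exp_le_one_iff.2 ?_)
    have : (0 : ℝ) ≤ k := Nat.cast_nonneg _
    linarith
  choose N h1 h2 h3 using fun k : ℕ =>
    h (e * Real.exp (-(((k : ℝ) + 1) / 2))) (by positivity) (hr k)
  refine ⟨C * (Real.exp (1 / 2) / e) ^ d, N, h1, fun k => (h2 k).trans (le_of_eq ?_), h3⟩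
  have hx : 1 / (e * Real.exp (-(((k : ℝ) + 1) / 2))) =
      Real.exp (1 / 2) / e * Real.exp (k / 2) := by
    rw [Real.exp_neg, add_div, Real.exp_add]
    field_simp
  rw [hx, mul_pow, ← Real.exp_nat_mul (↑k / 2) d, ← mul_assoc]
  congr 2
  ring

/-- Deterministic step: absence of line crossings on the current scale bounds the self-normalized
process. -/
theorem norm_invSqrt_div_le {e l0 : ℝ} {J : ℕ} (he : 0 < e) (he1 : e < 1) (hl0 : 0 < l0)
    (hψ : ∀ l, 0 < l → l < l0 → ψ l ≤ (1 + e) * (l ^ 2 / 2))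
    {N : ℕ → Finset (EuclideanSpace ℝ (Fin d))} (hN : ∀ k, ∀ x ∈ N k, ‖x‖ = 1)
    (hnet : ∀ k : ℕ, ∀ ν : EuclideanSpace ℝ (Fin d), ‖ν‖ = 1 →
        ∃ x ∈ N k, ‖ν - x‖ ≤ e * Real.exp (-((k + 1) / 2)))
    {A : Matrix (Fin d) (Fin d) ℝ} {s : EuclideanSpace ℝ (Fin d)} (hA : A.IsHermitian)
    (hJ : ∀ k j, J ≤ j → 0 < crossSlope e d k j → crossSlope e d k j < l0 →
      ∀ x ∈ N k, crossSlope e d k j * inner ℝ x s -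
        ψ (crossSlope e d k j) * inner ℝ x (matAct A x) < crossLevel e d k j)
    (hab : gammaMin A ≤ gammaMax A) (ha1 : 1 ≤ gammaMin A) (haJ : (1 + e) ^ (J + 2) ≤ gammaMin A)
    (hpos : 0 < Real.log (Real.log (gammaMax A)))
    (hb : -Real.log (Real.log (1 + e)) ≤ e * Real.log (Real.log (gammaMax A)))
    (hsmall : (1 + e) ^ 3 * (2 + d) * (Real.log (gammaMax A) / gammaMin A) < l0 ^ 2) :
    ‖matAct (invSqrt A) s‖ /
      √(2 * Real.log (Real.log (gammaMax A)) + d * Real.log (condNumber A)) ≤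
        (1 + e) ^ 4 / (1 - e) := by
  have ha0 : 0 < gammaMin A := by linarith
  have hκ1 : 1 ≤ condNumber A := (one_le_div ha0).2 hab
  have hκ0 : 0 ≤ Real.log (condNumber A) := Real.log_nonneg hκ1
  set D := 2 * Real.log (Real.log (gammaMax A)) + d * Real.log (condNumber A) with hD
  have hDpos : 0 < D := by
    have : 0 ≤ d * Real.log (condNumber A) := mul_nonneg (Nat.cast_nonneg _) hκ0
    linarith
  set k := ⌊Real.log (condNumber A)⌋₊
  have hk : (k : ℝ) ≤ Real.log (condNumber A) := Nat.floor_le hκ0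
  have hk' : √(condNumber A) ≤ Real.exp ((k + 1) / 2) := by
    rw [Real.sqrt_le_left (Real.exp_pos _).le, ← Real.exp_nat_mul]
    calc condNumber A = Real.exp (Real.log (condNumber A)) := (Real.exp_log (by linarith)).symm
      _ ≤ Real.exp (k + 1) := Real.exp_le_exp.2 (Nat.lt_floor_add_one _).le
      _ = _ := by congr 1; push_cast; ring
  have hre : e * Real.exp (-((k + 1 : ℝ) / 2)) * √(condNumber A) ≤ e := by
    calc _ ≤ e * Real.exp (-((k + 1 : ℝ) / 2)) * Real.exp ((k + 1) / 2) := by gcongr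
      _ = e := by rw [mul_assoc, ← Real.exp_add]; simp
  have hs : ∀ x ∈ (N k : Set (EuclideanSpace ℝ (Fin d))),
      inner ℝ x s ≤ (1 + e) ^ 3 * √D * √(inner ℝ x (matAct A x)) := by
    intro x hx
    have hx1 := hN k x hx
    have hva := gammaMin_mul_sq_le hA x
    have hvb := inner_matAct_le_gammaMax_mul_sq hA x
    rw [hx1, one_pow, mul_one] at hva hvb
    set v : ℝ := inner ℝ x (matAct A x)
    -- The scale `j` depends on the direction `x`. The exponent `J + 2` in `haJ` forces both `j ≥ J`
    -- and `j ≥ 2`, the latter making `log j` positive.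
    obtain ⟨j, hj1, hj2⟩ := exists_nat_pow_near (ha1.trans hva) (show 1 < 1 + e by linarith)
    have hjJ : J + 2 < j + 1 :=
      (pow_lt_pow_iff_right₀ (show 1 < 1 + e by linarith)).1 (by linarith)
    have hj : 2 ≤ j := by omega
    have hl := crossLevel_pos he (d := d) (k := k) hj
    have h0 : 0 < crossSlope e d k j := Real.sqrt_pos.2 (by positivity)
    have h1 : crossSlope e d k j < l0 :=
      crossSlope_lt he hl0 ha1 hab hj (hj1.trans hvb) (hva.trans hj2.le) hk hb hsmall
    have h2 := two_mul_crossLevel_le (d := d) he ha1 hab hj (hj1.trans hvb) hk hb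
    have h3 := le_of_not_crossing he.le hl (show 0 < (1 + e) ^ j by positivity) hj1
      (by rw [← pow_succ']; exact hj2.le) (hψ _ h0 h1) (hJ k j (by omega) h0 h1 x hx)
    refine h3.trans ?_
    have h4 : √(2 * crossLevel e d k j) ≤ (1 + e) * √D := by
      rw [← Real.sqrt_sq (show 0 ≤ 1 + e by linarith), ← Real.sqrt_mul (by positivity)]
      exact Real.sqrt_le_sqrt h2
    calc (1 + e) ^ 2 * √(2 * crossLevel e d k j) * √v
        ≤ (1 + e) ^ 2 * ((1 + e) * √D) * √v := by gcongr
      _ = _ := by ring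
  have key := norm_invSqrt_le_of_net hA ha0 (F := (N k : Set (EuclideanSpace ℝ (Fin d))))
    (by positivity) (by positivity) he.le (hnet k) hre hs
  rw [div_le_div_iff₀ (Real.sqrt_pos.2 hDpos) (by linarith)]
  calc _ ≤ _ := key
    _ = _ := by ring

theorem IsVectorSubPsi.ae_eventually_norm_div_le (hSV : IsVectorSubPsi μ ℱ lmax ψ S V)
    (hd : 1 ≤ d) (hψ : IsCGFLike lmax ψ) (hψ0 : ψ ~[𝓝[>] 0] fun l : ℝ => l ^ 2 / 2)
    (hmin : ∀ᵐ ω ∂μ, Tendsto (fun t => gammaMin (V t ω)) atTop atTop)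
    (hlog : ∀ᵐ ω ∂μ, Tendsto (fun t => Real.log (gammaMax (V t ω)) / gammaMin (V t ω))
      atTop (𝓝 0)) {e : ℝ} (he : 0 < e) (he1 : e < 1) :
    ∀ᵐ ω ∂μ, ∀ᶠ t in atTop, ‖matAct (invSqrt (V t ω)) (S t ω)‖ /
      √(2 * Real.log (Real.log (gammaMax (V t ω))) + d * Real.log (condNumber (V t ω))) ≤
        (1 + e) ^ 4 / (1 - e) := by
  obtain ⟨l0, hl0, hl⟩ := exists_forall_le_of_isEquivalent hψ.lmax_pos hψ0 he
  obtain ⟨C, N, hN, hcard, hnet⟩ := exists_nets d he he1.le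
  filter_upwards [hmin, hlog, hSV.ae_exists_forall_not_crossing hd he
    (fun l h0 h1 => (hl l h0 h1).1) N hN hcard] with ω h1 h2 ⟨J, hJ⟩
  have hab : ∀ t, gammaMin (V t ω) ≤ gammaMax (V t ω) := fun t =>
    gammaMin_le_gammaMax hd (hSV.posSemidef_V t ω).isHermitian
  have hLL : Tendsto (fun t => Real.log (Real.log (gammaMax (V t ω)))) atTop atTop :=
    Real.tendsto_log_atTop.comp (Real.tendsto_log_atTop.comp (tendsto_atTop_mono hab h1))
  have h3 : Tendsto (fun t => (1 + e) ^ 3 * (2 + d) *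
      (Real.log (gammaMax (V t ω)) / gammaMin (V t ω))) atTop (𝓝 0) := by
    simpa using h2.const_mul ((1 + e) ^ 3 * (2 + d))
  filter_upwards [h1.eventually_ge_atTop 1, h1.eventually_ge_atTop ((1 + e) ^ (J + 2)),
    hLL.eventually_gt_atTop 0, (hLL.const_mul_atTop he).eventually_ge_atTop
      (-Real.log (Real.log (1 + e))), h3.eventually_lt_const (show 0 < l0 ^ 2 by positivity)]
    with t e1 e2 e3 e4 e5
  exact norm_invSqrt_div_le he he1 hl0 (fun l h0 h1 => (hl l h0 h1).2) hN hnet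
    (hSV.posSemidef_V t ω).isHermitian (fun k j hj h0 h1 x hx => hJ k j hj h0 h1 x hx t)
    (hab t) e1 e2 e3 e4 e5

end Crossing

/-! ### Letting `e` tend to zero. -/

theorem corollary4p2 {Ω : Type*} {m0 : MeasurableSpace Ω} (μ : Measure Ω) [IsProbabilityMeasure μ]
    (ℱ : Filtration ℕ m0) (d : ℕ) (hd : 1 ≤ d) (lmax : EReal) (ψ : ℝ → ℝ)
    (hψ : IsCGFLike lmax ψ)
    (S : ℕ → Ω → EuclideanSpace ℝ (Fin d)) (V : ℕ → Ω → Matrix (Fin d) (Fin d) ℝ)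
    (hSV : IsVectorSubPsi μ ℱ lmax ψ S V)
    (hψ0 : ψ ~[𝓝[>] 0] fun l : ℝ => l ^ 2 / 2)
    (hmin : ∀ᵐ ω ∂μ, Tendsto (fun t => gammaMin (V t ω)) atTop atTop)
    (hlog : ∀ᵐ ω ∂μ, Tendsto (fun t => Real.log (gammaMax (V t ω)) / gammaMin (V t ω))
      atTop (𝓝 0)) :
    ∀ᵐ ω ∂μ,
      limsup (fun t : ℕ =>
        ((‖matAct (invSqrt (V t ω)) (S t ω)‖ /
            √(2 * Real.log (Real.log (gammaMax (V t ω))) + d * Real.log (condNumber (V t ω))) : ℝ)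
          : EReal)) atTop ≤ 1 := by
  -- Countably many values `e = 1/(n+2)` in `(0, 1)` leave a single null set.
  have hae : ∀ n : ℕ, _ := fun n => hSV.ae_eventually_norm_div_le hd hψ hψ0 hmin hlog
    (e := 1 / ((n : ℝ) + 2)) (by positivity)
    (by rw [div_lt_one (by positivity)]; linarith [Nat.cast_nonneg (α := ℝ) n])
  filter_upwards [ae_all_iff.2 hae] with ω hω
  have hlim0 : Tendsto (fun n : ℕ => 1 / ((n : ℝ) + 2)) atTop (𝓝 0) :=
    tendsto_const_nhds.div_atTop (tendsto_natCast_atTop_atTop.atTop_add tendsto_const_nhds)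
  have hlim : Tendsto (fun n : ℕ => (1 + 1 / ((n : ℝ) + 2)) ^ 4 / (1 - 1 / ((n : ℝ) + 2))) atTop
      (𝓝 1) := by
    have := ((hlim0.const_add 1).pow 4).div (hlim0.const_sub 1) (by norm_num)
    simpa [Pi.div_def] using this
  have hlim' := (continuous_coe_real_ereal.tendsto 1).comp hlim
  refine ge_of_tendsto' hlim' fun n => ?_
  refine limsup_le_of_le (by isBoundedDefault) ?_
  filter_upwards [hω n] with t ht
  exact EReal.coe_le_coe_iff.2 ht
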